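/- Let $\operatorname{sinc}(t)=\frac{\sin(\pi t)}{\pi t}$ for $t\neq 0$ and $\operatorname{sinc}(0)=1$. For $d\in\mathbb{N}$ and an integer $n\ge 1$, let $$\Theta^n(x,\omega)=\operatorname{sinc}^n(x\cdot\omega),\qquad (x,\omega)\in\mathbb{R}^d\times\mathbb{R}^d=\mathbb{R}^{2d},$$ be the $n$-th Born–Jordan kernel, regarded as a tempered distribution on $\mathbb{R}^{2d}$. For a Schwartz function $g\in\mathcal{S}(\mathbb{R}^{2d})\setminus\{0\}$ and $f\in\mathcal{S}'(\mathbb{R}^{2d})$, let $$V_gf(z,\zeta)=\int_{\mathbb{R}^{2d}} f(y)\,\overline{g(y-z)}\,e^{-2\pi i\, y\cdot\zeta}\,dy,\qquad z,\zeta\in\mathbb{R}^{2d},$$ be the short-time Fourier transform of $f$ (the integral being understood as a distributional pairing), and let $W(\mathcal{F}L^1,L^\infty)(\mathbb{R}^{2d})$ be the space of all $f\in\mathcal{S}'(\mathbb{R}^{2d})$ such that $$\operatorname*{ess\,sup}_{z\in\mathbb{R}^{2d}}\int_{\mathbb{R}^{2d}}|V_gf(z,\zeta)|\,d\zeta<\infty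 .$$ Then $\Theta^n\in W(\mathcal{F}L^1,L^\infty)(\mathbb{R}^{2d})$ for every $n\ge 1$ and every choice of the window $g\neq 0$. -/

import Mathlib

open MeasureTheory
open scoped SchwartzMap ENNReal

noncomputable section

namespace BornJordan

section STFT

variable {V : Type*} [NormedAddCommGroup V] [InnerProductSpace ℝ V]

/-- The character `y ↦ exp (-2 π i ⟨y, ω⟩)`. -/
def character (ω : V) : V → ℂ :=
  fun y => Complex.exp (-(2 * Real.pi * inner ℝ y ω : ℝ) * Complex.I)

theorem hasTemperateGrowth_exp_I :
    Function.HasTemperateGrowth (fun t : ℝ => Complex.exp (t * Complex.I)) := by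
  have hc : ContDiff ℝ (⊤ : ℕ∞) (fun t : ℝ => Complex.exp (t * Complex.I)) :=
    (Complex.ofRealCLM.contDiff.mul contDiff_const).cexp
  refine ⟨hc, fun n => ⟨0, 1, fun t => ?_⟩⟩
  have key : ∀ n : ℕ, iteratedDeriv n (fun t : ℝ => Complex.exp (t * Complex.I)) =
      fun t : ℝ => Complex.I ^ n * Complex.exp (t * Complex.I) := by
    intro n
    induction n with
    | zero => simp
    | succ n ih =>
      rw [iteratedDeriv_succ, ih]
      funext t
      have h1 : HasDerivAt (fun t : ℝ => (t : ℂ) * Complex.I) (1 * Complex.I) t :=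
        (Complex.ofRealCLM.hasDerivAt (x := t)).mul_const Complex.I
      have h2 := (h1.cexp.const_mul (Complex.I ^ n)).deriv
      rw [h2]
      ring
  rw [norm_iteratedFDeriv_eq_norm_iteratedDeriv, key]
  simp [Complex.norm_exp_ofReal_mul_I]

theorem hasTemperateGrowth_character (ω : V) : (character ω).HasTemperateGrowth := by
  have h := hasTemperateGrowth_exp_I.comp
    (((-(2 * Real.pi)) • (innerSL ℝ ω : V →L[ℝ] ℝ)).hasTemperateGrowth)
  convert h using 1
  funext y
  simp [character, real_inner_comm]

/-- The Schwartz function `y ↦ conj (g (y - x)) * exp (-2 π i ⟨y, ω⟩)` against which a tempered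
distribution is tested in its short-time Fourier transform with window `g`
(see `stftAtom_apply`). -/
def stftAtom (g : 𝓢(V, ℂ)) (x ω : V) : 𝓢(V, ℂ) :=
  SchwartzMap.smulLeftCLM ℂ (character ω)
    (SchwartzMap.postcompCLM (𝕜 := ℝ) (Complex.conjCLE : ℂ →L[ℝ] ℂ)
      (SchwartzMap.compSubConstCLM ℝ x g))

theorem stftAtom_apply (g : 𝓢(V, ℂ)) (x ω y : V) :
    stftAtom g x ω y = (starRingEnd ℂ) (g (y - x)) *
      Complex.exp (-(2 * Real.pi * inner ℝ y ω : ℝ) * Complex.I) := by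
  rw [stftAtom, SchwartzMap.smulLeftCLM_apply_apply (hasTemperateGrowth_character ω)]
  simp [character, mul_comm]

/-- The short-time Fourier transform `V_g f (x, ω)` of a tempered distribution `f` with window `g`,
that is `∫ f(y) conj (g (y - x)) exp (-2 π i ⟨y, ω⟩) dy`, the integral being the (bilinear) pairing
of `f` with `stftAtom g x ω`. -/
def stft (g : 𝓢(V, ℂ)) (f : 𝓢'(V, ℂ)) (x ω : V) : ℂ := f (stftAtom g x ω)

variable [FiniteDimensional ℝ V] [MeasurableSpace V] [BorelSpace V]

/-- The norm of `W(FL^p, L^q)`: the `L^q` norm in `x` of the `L^p` norm in `ω` of `V_g f (x, ω)`,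
with value `∞` allowed (for exponent `∞` the essential supremum is taken). -/
def wienerAmalgamNorm (g : 𝓢(V, ℂ)) (p q : ℝ≥0∞) (f : 𝓢'(V, ℂ)) : ℝ≥0∞ :=
  eLpNorm (fun x : V => eLpNorm (fun ω : V => stft g f x ω) p volume) q volume

/-- The space `W(FL^p, L^q)`, its norm being measured with the window `g`. -/
def wienerAmalgam (g : 𝓢(V, ℂ)) (p q : ℝ≥0∞) : Set 𝓢'(V, ℂ) :=
  {f | wienerAmalgamNorm g p q f < ∞}

end STFT

section Kernel

/-- The phase space `ℝ^{2d}`: a point `z` is the pair `(x, ω)` with `x i = z (Sum.inl i)` and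
`ω i = z (Sum.inr i)`. -/
abbrev PhaseSpace (d : ℕ) : Type := EuclideanSpace ℝ (Fin d ⊕ Fin d)

/-- The function `Θ^n (x, ω) = sinc^n (x · ω)`, where `sinc t = sin (π t) / (π t)` for `t ≠ 0` and
`sinc 0 = 1` (Mathlib's `Real.sinc` does not include the factor `π`). -/
def kernel (d n : ℕ) (z : PhaseSpace d) : ℂ :=
  ((Real.sinc (Real.pi * ∑ i : Fin d, z (Sum.inl i) * z (Sum.inr i)) ^ n : ℝ) : ℂ)

theorem continuous_kernel (d n : ℕ) : Continuous (kernel d n) := by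
  unfold kernel
  refine Complex.continuous_ofReal.comp ((Real.continuous_sinc.comp ?_).pow n)
  fun_prop

theorem norm_kernel_le_one (d n : ℕ) (z : PhaseSpace d) : ‖kernel d n z‖ ≤ 1 := by
  rw [kernel, Complex.norm_real, norm_pow, Real.norm_eq_abs]
  exact pow_le_one₀ (abs_nonneg _) (Real.abs_sinc_le_one _)

theorem memLp_top_kernel (d n : ℕ) : MemLp (kernel d n) ∞ (volume : Measure (PhaseSpace d)) :=
  memLp_top_of_bound (continuous_kernel d n).aestronglyMeasurable 1
    (Filter.Eventually.of_forall (norm_kernel_le_one d n))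

/-- The tempered distribution defined by the bounded continuous function `Θ^n`. -/
def kernelDistribution (d n : ℕ) : 𝓢'(PhaseSpace d, ℂ) :=
  Lp.toTemperedDistribution (memLp_top_kernel d n).toLp

theorem kernelDistribution_apply (d n : ℕ) (φ : 𝓢(PhaseSpace d, ℂ)) :
    kernelDistribution d n φ = ∫ z, φ z * kernel d n z := by
  rw [kernelDistribution, Lp.toTemperedDistribution_apply]
  refine integral_congr_ae ?_
  filter_upwards [(memLp_top_kernel d n).coeFn_toLp] with z hz
  rw [hz, smul_eq_mul]

end Kernel

end BornJordan

end

/-! Since sinc is the Fourier transform of the indicator of [-1/2, 1/2], Θ^n is an average of chirps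
exp(πi s⟨z, Az⟩), where A swaps x and ω and s is a sum of n uniform variables, hence bounded
(`kernel_eq_integral_chirp`). Translation turns a chirp into itself times a character and a
unimodular constant, so |V_g| of a chirp at (z, ζ) is |𝓕(chirp · conj g)(ζ - sAz)|
(`norm_integral_stftAtom_mul_chirp`), and its L^1 norm in ζ does not depend on z. That norm is
bounded uniformly for bounded s (`exists_lintegral_fourier_chirp_le`); averaging over s preserves
the bound. -/

namespace BornJordan

/-! ### Bounded families of Schwartz functions -/

section Boundedness

variable {E V : Type*} [NormedAddCommGroup E] [NormedSpace ℝ E]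
  [NormedAddCommGroup V] [NormedSpace ℝ V]

theorem norm_iteratedFDeriv_comp_prodMk_le {F : Type*} [NormedAddCommGroup F] [NormedSpace ℝ F]
    {G : E × V → F} {m : ℕ} (hG : ContDiff ℝ m G) (s : E) (y : V) :
    ‖iteratedFDeriv ℝ m (fun v => G (s, v)) y‖ ≤ ‖iteratedFDeriv ℝ m G (s, y)‖ := by
  have hcomp : (fun v => G (s, v)) =
      (fun p => G (p + (s, 0))) ∘ (ContinuousLinearMap.inr ℝ E V) := by
    funext v
    simp
  have hshift : ContDiff ℝ m (fun p : E × V => G (p + (s, 0))) := by fun_prop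
  rw [hcomp, ContinuousLinearMap.iteratedFDeriv_comp_right _ hshift y le_rfl,
    iteratedFDeriv_comp_add_right]
  refine (ContinuousMultilinearMap.norm_compContinuousLinearMap_le _ _).trans ?_
  simp only [ContinuousLinearMap.inr_apply, Prod.mk_add_mk, zero_add, add_zero]
  refine mul_le_of_le_one_right (norm_nonneg _) (Finset.prod_le_one (fun _ _ => norm_nonneg _) ?_)
  exact fun _ _ => ContinuousLinearMap.norm_inr_le_one ℝ E V

theorem hasTemperateGrowth_comp_prodMk {F : Type*} [NormedAddCommGroup F] [NormedSpace ℝ F]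
    {G : E × V → F} (hG : G.HasTemperateGrowth) (s : E) :
    Function.HasTemperateGrowth (fun v => G (s, v)) := by
  have h : Function.HasTemperateGrowth (fun v : V => (s, v)) := by
    convert ((ContinuousLinearMap.inr ℝ E V).hasTemperateGrowth).add
      (Function.HasTemperateGrowth.const (s, (0 : V))) using 1
    funext v
    simp
  exact hG.comp h

/-- Multiplying a Schwartz function by a function of temperate growth which depends on a bounded
parameter gives a bounded family of Schwartz functions. -/
theorem exists_seminorm_smulLeftCLM_le {G : E × V → ℂ} (hG : G.HasTemperateGrowth) (R : ℝ)
    (φ : 𝓢(V, ℂ)) (k m : ℕ) :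
    ∃ C, 0 ≤ C ∧ ∀ s : E, ‖s‖ ≤ R →
      SchwartzMap.seminorm ℂ k m (SchwartzMap.smulLeftCLM ℂ (fun y => G (s, y)) φ) ≤ C := by
  -- One pair `l`, `C` serves all orders up to `m`, hence every term of the Leibniz rule.
  obtain ⟨l, C, hC, hbound⟩ := hG.norm_iteratedFDeriv_le_uniform m
  set M := 2 ^ (l + k) *
    (Finset.Iic (l + k, m)).sup (fun m => SchwartzMap.seminorm ℂ m.1 m.2) φ with hM
  have hM0 : 0 ≤ M := by positivity
  refine ⟨∑ i ∈ Finset.range (m + 1), (m.choose i : ℝ) * (C * (1 + |R|) ^ l * M), by positivity,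
    fun s hs => SchwartzMap.seminorm_le_bound _ _ _ _ (by positivity) fun y => ?_⟩
  have hs' : ‖s‖ ≤ |R| := hs.trans (le_abs_self R)
  have hGs := hasTemperateGrowth_comp_prodMk hG s
  have hcoe : ⇑(SchwartzMap.smulLeftCLM ℂ (fun y => G (s, y)) φ) = fun y => G (s, y) * φ y := by
    funext y
    rw [SchwartzMap.smulLeftCLM_apply_apply hGs, smul_eq_mul]
  rw [hcoe]
  have hmul := norm_iteratedFDeriv_mul_le hGs.1 (φ.smooth ⊤) y (n := m) (mod_cast le_top)
  refine (mul_le_mul_of_nonneg_left hmul (by positivity)).trans ?_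
  rw [Finset.mul_sum]
  refine Finset.sum_le_sum fun i hi => ?_
  have hi' : i ≤ m := Nat.lt_succ_iff.1 (Finset.mem_range.1 hi)
  have h1 : ‖iteratedFDeriv ℝ i (fun v => G (s, v)) y‖ ≤ C * ((1 + |R|) ^ l * (1 + ‖y‖) ^ l) := by
    refine (norm_iteratedFDeriv_comp_prodMk_le (hG.1.of_le (mod_cast le_top)) s y).trans
      ((hbound i hi' (s, y)).trans ?_)
    rw [← mul_pow]
    gcongr
    -- This gives 1 + ‖(s, y)‖ ≤ (1 + |R|)(1 + ‖y‖), separating the parameter from `y`.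
    have h2 : ‖(s, y)‖ ≤ |R| + ‖y‖ :=
      max_le (by have := norm_nonneg y; simp only; linarith) (by simp)
    nlinarith [mul_nonneg (abs_nonneg R) (norm_nonneg y)]
  have h2 : (1 + ‖y‖) ^ (l + k) * ‖iteratedFDeriv ℝ (m - i) φ y‖ ≤ M :=
    SchwartzMap.one_add_le_sup_seminorm_apply (m := (l + k, m)) le_rfl (Nat.sub_le m i) φ y
  calc ‖y‖ ^ k * ((m.choose i : ℝ) * ‖iteratedFDeriv ℝ i (fun v => G (s, v)) y‖ *
        ‖iteratedFDeriv ℝ (m - i) φ y‖)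
      ≤ (1 + ‖y‖) ^ k * ((m.choose i : ℝ) * (C * ((1 + |R|) ^ l * (1 + ‖y‖) ^ l)) *
        ‖iteratedFDeriv ℝ (m - i) φ y‖) := by
        gcongr
        simp
    _ = (m.choose i : ℝ) * (C * (1 + |R|) ^ l *
        ((1 + ‖y‖) ^ (l + k) * ‖iteratedFDeriv ℝ (m - i) φ y‖)) := by ring
    _ ≤ _ := by gcongr

end Boundedness

/-! ### Short-time Fourier transform of chirps -/

section Chirp

variable {V : Type*} [NormedAddCommGroup V] [InnerProductSpace ℝ V]

/-- The chirp `y ↦ exp (π i s ⟨y, A y⟩)`. -/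
noncomputable def chirp (A : V →L[ℝ] V) (s : ℝ) (y : V) : ℂ :=
  Complex.exp ((Real.pi * s * inner ℝ y (A y) : ℝ) * Complex.I)

theorem norm_chirp (A : V →L[ℝ] V) (s : ℝ) (y : V) : ‖chirp A s y‖ = 1 :=
  Complex.norm_exp_ofReal_mul_I _

theorem continuous_chirp (A : V →L[ℝ] V) : Continuous fun p : ℝ × V => chirp A p.1 p.2 := by
  unfold chirp
  fun_prop

theorem hasTemperateGrowth_chirp (A : V →L[ℝ] V) :
    Function.HasTemperateGrowth (fun p : ℝ × V => chirp A p.1 p.2) := by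
  have h1 : Function.HasTemperateGrowth (fun p : ℝ × V => p.1) :=
    (ContinuousLinearMap.fst ℝ ℝ V).hasTemperateGrowth
  have h2 : Function.HasTemperateGrowth (fun p : ℝ × V => p.2) :=
    (ContinuousLinearMap.snd ℝ ℝ V).hasTemperateGrowth
  have h3 : Function.HasTemperateGrowth (fun p : ℝ × V => A p.2) :=
    (A ∘L ContinuousLinearMap.snd ℝ ℝ V).hasTemperateGrowth
  have h4 : Function.HasTemperateGrowth (fun p : ℝ × V => inner ℝ p.2 (A p.2)) :=
    (innerSL ℝ : V →L[ℝ] V →L[ℝ] ℝ).bilinear_hasTemperateGrowth h2 h3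
  exact hasTemperateGrowth_exp_I.comp
    (((Function.HasTemperateGrowth.const Real.pi).mul h1).mul h4)

theorem hasTemperateGrowth_chirp_right (A : V →L[ℝ] V) (s : ℝ) :
    (chirp A s).HasTemperateGrowth :=
  hasTemperateGrowth_comp_prodMk (hasTemperateGrowth_chirp A) s

/-- The complex conjugate of a Schwartz function. -/
noncomputable def conjSchwartz (g : 𝓢(V, ℂ)) : 𝓢(V, ℂ) :=
  SchwartzMap.postcompCLM (𝕜 := ℝ) (Complex.conjCLE : ℂ →L[ℝ] ℂ) g

theorem conjSchwartz_apply (g : 𝓢(V, ℂ)) (y : V) :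
    conjSchwartz g y = (starRingEnd ℂ) (g y) := by
  simp [conjSchwartz]

theorem continuous_stftAtom_mul_chirp (A : V →L[ℝ] V) (g : 𝓢(V, ℂ)) (z : V) :
    Continuous fun p : (V × ℝ) × V => stftAtom g z p.1.1 p.2 * chirp A p.1.2 p.2 := by
  simp only [stftAtom_apply, chirp]
  have := g.continuous
  fun_prop

variable [FiniteDimensional ℝ V] [MeasurableSpace V] [BorelSpace V]

open scoped FourierTransform in
-- The products chirp · φ form a bounded set in Schwartz space, and the Fourier transform into L^1,
-- being continuous and linear, maps bounded sets to bounded sets.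
theorem exists_lintegral_fourier_chirp_le (A : V →L[ℝ] V) (φ : 𝓢(V, ℂ)) (R : ℝ) :
    ∃ C : ℝ, ∀ s : ℝ, |s| ≤ R →
      ∫⁻ ζ, ‖𝓕 (SchwartzMap.smulLeftCLM ℂ (chirp A s) φ) ζ‖ₑ ≤ ENNReal.ofReal C := by
  let T : 𝓢(V, ℂ) →L[ℂ] Lp ℂ 1 (volume : Measure V) :=
    SchwartzMap.toLpCLM ℂ ℂ 1 volume ∘L SchwartzMap.fourierTransformCLM ℂ
  have hbdd : Bornology.IsVonNBounded ℂ
      ((fun s : ℝ => SchwartzMap.smulLeftCLM ℂ (chirp A s) φ) '' {s | |s| ≤ R}) := by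
    rw [(schwartz_withSeminorms ℂ V ℂ).image_isVonNBounded_iff_seminorm_bounded]
    rintro ⟨k, m⟩
    obtain ⟨C, hC, h⟩ := exists_seminorm_smulLeftCLM_le (hasTemperateGrowth_chirp A) R φ k m
    exact ⟨C + 1, by positivity, fun s hs => (h s hs).trans_lt (lt_add_one C)⟩
  obtain ⟨C, hC⟩ := (NormedSpace.isVonNBounded_iff' ℂ).1 (hbdd.image T)
  refine ⟨C, fun s hs => ?_⟩
  have h := hC _ (Set.mem_image_of_mem T (Set.mem_image_of_mem _ hs))
  have hT : T (SchwartzMap.smulLeftCLM ℂ (chirp A s) φ) =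
      (𝓕 (SchwartzMap.smulLeftCLM ℂ (chirp A s) φ)).toLp 1 volume := rfl
  rw [hT, SchwartzMap.norm_toLp, eLpNorm_one_eq_lintegral_enorm] at h
  have hfin : ∫⁻ ζ, ‖𝓕 (SchwartzMap.smulLeftCLM ℂ (chirp A s) φ) ζ‖ₑ ≠ ∞ :=
    (𝓕 (SchwartzMap.smulLeftCLM ℂ (chirp A s) φ)).integrable.2.ne
  exact (ENNReal.le_ofReal_iff_toReal_le hfin (ENNReal.toReal_nonneg.trans h)).2 h

open scoped FourierTransform in
/-- Covariance of the short-time Fourier transform of a chirp. -/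
theorem norm_integral_stftAtom_mul_chirp {A : V →L[ℝ] V} (hA : A.toLinearMap.IsSymmetric)
    (g : 𝓢(V, ℂ)) (s : ℝ) (z ζ : V) :
    ‖∫ y, stftAtom g z ζ y * chirp A s y‖ =
      ‖𝓕 (SchwartzMap.smulLeftCLM ℂ (chirp A s) (conjSchwartz g)) (ζ - s • A z)‖ := by
  -- By symmetry of `A` the cross terms sum to 2⟨y, Az⟩, which shifts the frequency ζ by sAz.
  have hpt : ∀ y, stftAtom g z ζ (y + z) * chirp A s (y + z) =
      Complex.exp ((-(2 * Real.pi * inner ℝ z ζ) + Real.pi * s * inner ℝ z (A z) : ℝ) * Complex.I) *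
        (Complex.exp ((-2 * Real.pi * inner ℝ y (ζ - s • A z) : ℝ) * Complex.I) •
          SchwartzMap.smulLeftCLM ℂ (chirp A s) (conjSchwartz g) y) := by
    intro y
    have hsymm : inner ℝ z (A y) = inner ℝ y (A z) := by
      rw [real_inner_comm]
      exact hA y z
    rw [stftAtom_apply, SchwartzMap.smulLeftCLM_apply_apply (hasTemperateGrowth_chirp_right A s),
      conjSchwartz_apply, add_sub_cancel_right, smul_eq_mul, smul_eq_mul, chirp, chirp]
    rw [mul_assoc, ← Complex.exp_add, mul_comm, ← mul_assoc, ← mul_assoc, ← Complex.exp_add,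
      ← Complex.exp_add]
    congr 2
    simp only [map_add, inner_add_left, inner_add_right, inner_sub_right, inner_smul_right, hsymm]
    push_cast
    ring
  rw [← integral_add_right_eq_self _ z, integral_congr_ae (Filter.Eventually.of_forall hpt),
    integral_const_mul, norm_mul, Complex.norm_exp_ofReal_mul_I, one_mul,
    SchwartzMap.fourier_coe, Real.fourier_eq']

variable {X : Type*} [MeasurableSpace X] {μ : Measure X} [IsFiniteMeasure μ]

/-- A superposition of chirps `exp (π i θ ⟨y, A y⟩)`, with `θ` bounded, belongs to
`W(FL^1, L^∞)`. -/
theorem mem_wienerAmalgam_of_integral_chirp {A : V →L[ℝ] V} (hA : A.toLinearMap.IsSymmetric)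
    {θ : X → ℝ} (hθ : Measurable θ) {R : ℝ} (hR : ∀ᵐ x ∂μ, |θ x| ≤ R) (g : 𝓢(V, ℂ))
    {f : 𝓢'(V, ℂ)} (hf : ∀ φ : 𝓢(V, ℂ), f φ = ∫ y, φ y * ∫ x, chirp A (θ x) y ∂μ) :
    f ∈ wienerAmalgam g 1 ∞ := by
  obtain ⟨C, hC⟩ := exists_lintegral_fourier_chirp_le A (conjSchwartz g) R
  have hstft : ∀ z ζ, stft g f z ζ = ∫ x, ∫ y, stftAtom g z ζ y * chirp A (θ x) y ∂volume ∂μ := by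
    intro z ζ
    rw [stft, hf]
    simp_rw [← integral_const_mul]
    -- Fubini applies: chirps are unimodular, the atom is integrable and `μ` is finite.
    refine integral_integral_swap ?_
    refine ((stftAtom g z ζ).integrable.comp_fst μ).mul_bdd (c := 1) ?_ ?_
    · exact ((continuous_chirp A).measurable.comp
        ((hθ.comp measurable_snd).prodMk measurable_fst)).aestronglyMeasurable
    · exact Filter.Eventually.of_forall fun p => (norm_chirp A _ _).le
  have hmeas : ∀ z, Measurable fun p : V × X =>
      ‖∫ y, stftAtom g z p.1 y * chirp A (θ p.2) y‖ₑ := by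
    intro z
    have h : StronglyMeasurable fun p : (V × X) × V =>
        stftAtom g z p.1.1 p.2 * chirp A (θ p.1.2) p.2 :=
      ((continuous_stftAtom_mul_chirp A g z).measurable.comp
        (((measurable_fst.comp measurable_fst).prodMk
          (hθ.comp (measurable_snd.comp measurable_fst))).prodMk measurable_snd)).stronglyMeasurable
    exact h.integral_prod_right.measurable.enorm
  have hbound : ∀ z, eLpNorm (fun ζ => stft g f z ζ) 1 volume ≤ ENNReal.ofReal C * μ Set.univ := by
    intro z
    rw [eLpNorm_one_eq_lintegral_enorm]
    calc ∫⁻ ζ, ‖stft g f z ζ‖ₑ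
        ≤ ∫⁻ ζ, ∫⁻ x, ‖∫ y, stftAtom g z ζ y * chirp A (θ x) y‖ₑ ∂μ := by
          refine lintegral_mono fun ζ => ?_
          rw [hstft]
          exact enorm_integral_le_lintegral_enorm _
      _ = ∫⁻ x, ∫⁻ ζ, ‖∫ y, stftAtom g z ζ y * chirp A (θ x) y‖ₑ ∂volume ∂μ :=
          lintegral_lintegral_swap (hmeas z).aemeasurable
      _ ≤ ∫⁻ _, ENNReal.ofReal C ∂μ := by
          refine lintegral_mono_ae (hR.mono fun x hx => ?_)
          refine le_trans (le_of_eq ?_) (hC (θ x) hx)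
          -- Translation invariance in ζ absorbs the shift sAz, and with it all dependence on `z`.
          rw [← lintegral_sub_right_eq_self (fun ζ => ‖FourierTransform.fourier
            (SchwartzMap.smulLeftCLM ℂ (chirp A (θ x)) (conjSchwartz g)) ζ‖ₑ) (θ x • A z)]
          refine lintegral_congr fun ζ => ?_
          rw [← ofReal_norm, ← ofReal_norm, norm_integral_stftAtom_mul_chirp hA]
      _ = ENNReal.ofReal C * μ Set.univ := lintegral_const _
  have hfin : ENNReal.ofReal C * μ Set.univ < ∞ :=
    ENNReal.mul_lt_top ENNReal.ofReal_lt_top (measure_lt_top μ _)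
  change eLpNorm _ ∞ volume < ∞
  rw [eLpNorm_exponent_top]
  exact (essSup_le_of_ae_le _ (Filter.Eventually.of_forall hbound)).trans_lt hfin

end Chirp

/-! ### The Born–Jordan kernel as an average of chirps -/

section Kernel

/-- The exchange `(x, ω) ↦ (ω, x)` on phase space. -/
noncomputable def phaseSwap (d : ℕ) : PhaseSpace d →L[ℝ] PhaseSpace d :=
  (LinearIsometryEquiv.piLpCongrLeft 2 ℝ ℝ
    (Equiv.sumComm (Fin d) (Fin d))).toContinuousLinearEquiv.toContinuousLinearMap

theorem phaseSwap_inl (d : ℕ) (z : PhaseSpace d) (i : Fin d) :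
    phaseSwap d z (Sum.inl i) = z (Sum.inr i) := rfl

theorem phaseSwap_inr (d : ℕ) (z : PhaseSpace d) (i : Fin d) :
    phaseSwap d z (Sum.inr i) = z (Sum.inl i) := rfl

theorem isSymmetric_phaseSwap (d : ℕ) : (phaseSwap d).toLinearMap.IsSymmetric := by
  intro y z
  simp [PiLp.inner_apply, Fintype.sum_sum_type, phaseSwap_inl, phaseSwap_inr, add_comm]

theorem inner_phaseSwap_self (d : ℕ) (z : PhaseSpace d) :
    inner ℝ z (phaseSwap d z) = 2 * ∑ i : Fin d, z (Sum.inl i) * z (Sum.inr i) := by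
  simp [PiLp.inner_apply, Fintype.sum_sum_type, phaseSwap_inl, phaseSwap_inr, two_mul, mul_comm]

theorem integral_exp_eq_sinc (t : ℝ) :
    ∫ s in Set.Icc (-(1 / 2) : ℝ) (1 / 2), Complex.exp ((2 * Real.pi * t * s : ℝ) * Complex.I) =
      (Real.sinc (Real.pi * t) : ℂ) := by
  rw [integral_Icc_eq_integral_Ioc, ← intervalIntegral.integral_of_le (by norm_num)]
  by_cases ht : t = 0
  · norm_num [ht]
  have hc : 2 * Real.pi * t ≠ 0 := by positivity
  rw [intervalIntegral.integral_comp_mul_left (fun u : ℝ => Complex.exp (u * Complex.I)) hc,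
    show 2 * Real.pi * t * -(1 / 2) = -(Real.pi * t) by ring,
    show 2 * Real.pi * t * (1 / 2) = Real.pi * t by ring, integral_exp_mul_I_eq_sinc,
    Complex.real_smul]
  have : (Real.pi : ℂ) ≠ 0 := by exact_mod_cast Real.pi_ne_zero
  have : (t : ℂ) ≠ 0 := by exact_mod_cast ht
  push_cast
  field_simp

/-- The Born–Jordan kernel as a superposition of chirps, the parameter being distributed as a sum
of `n` independent uniform variables on `[-1/2, 1/2]`. -/
theorem kernel_eq_integral_chirp (d n : ℕ) (z : PhaseSpace d) :
    kernel d n z = ∫ τ : Fin n → ℝ, chirp (phaseSwap d) (∑ j, τ j) z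
      ∂(Measure.pi fun _ => volume.restrict (Set.Icc (-(1 / 2) : ℝ) (1 / 2))) := by
  have h := integral_fintype_prod_eq_pow (ι := Fin n)
    (μ := volume.restrict (Set.Icc (-(1 / 2) : ℝ) (1 / 2)))
    (fun s : ℝ => Complex.exp ((2 * Real.pi * (∑ i : Fin d, z (Sum.inl i) * z (Sum.inr i)) * s : ℝ)
      * Complex.I))
  rw [integral_exp_eq_sinc, Fintype.card_fin] at h
  rw [kernel, Complex.ofReal_pow, ← h]
  refine integral_congr_ae (Filter.Eventually.of_forall fun τ => ?_)
  simp only [chirp]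
  rw [← Complex.exp_sum, ← Finset.sum_mul, ← Complex.ofReal_sum, ← Finset.mul_sum,
    inner_phaseSwap_self]
  congr 3
  ring

theorem ae_abs_sum_le (n : ℕ) :
    ∀ᵐ τ : Fin n → ℝ ∂(Measure.pi fun _ => volume.restrict (Set.Icc (-(1 / 2) : ℝ) (1 / 2))),
      |∑ j, τ j| ≤ n := by
  rw [← Measure.restrict_pi_pi]
  filter_upwards [ae_restrict_mem (MeasurableSet.univ_pi fun _ => measurableSet_Icc)] with τ hτ
  calc |∑ j, τ j| ≤ ∑ j, |τ j| := Finset.abs_sum_le_sum_abs _ _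
    -- Each term is at most 1/2; the cruder 1 suffices, as any bound on the parameter will do.
    _ ≤ ∑ _j : Fin n, (1 : ℝ) := by
        refine Finset.sum_le_sum fun j _ => ?_
        have h := hτ j (Set.mem_univ j)
        exact abs_le.2 ⟨by linarith [h.1], by linarith [h.2]⟩
    _ = n := by simp

end Kernel

end BornJordan

theorem proposition4p2 (d n : ℕ) (hn : 1 ≤ n)
    (g : 𝓢(BornJordan.PhaseSpace d, ℂ)) (hg : g ≠ 0) :
    BornJordan.kernelDistribution d n ∈ BornJordan.wienerAmalgam g 1 ∞ := by
  refine BornJordan.mem_wienerAmalgam_of_integral_chirp (BornJordan.isSymmetric_phaseSwap d)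
    (θ := fun τ : Fin n → ℝ => ∑ j, τ j) (by fun_prop) (BornJordan.ae_abs_sum_le n) g fun φ => ?_
  simp_rw [BornJordan.kernelDistribution_apply, BornJordan.kernel_eq_integral_chirp]
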